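/- Let $d,n\ge 1$ and $k\ge 0$ be integers and let $\Sigma\in\mathbb{R}^{d\times d}$ be symmetric positive definite. Let $x_1,\dots,x_{n+1}\sim\mathcal N(0,\Sigma)$ be i.i.d. and let $w_\star\sim\mathcal N(0,\Sigma^{-1})$ be independent of them. Put $y_i=\langle w_\star,x_i\rangle$ for $i\le n$, $$Z_0=\begin{bmatrix}x_1&\cdots&x_n&x_{n+1}\\ y_1&\cdots&y_n&0\end{bmatrix}\in\mathbb{R}^{(d+1)\times(n+1)},\qquad M=\begin{bmatrix}I_n&0\\0&0\end{bmatrix}\in\mathbb{R}^{(n+1)\times(n+1)}.$$ For $A=(A_i)_{i=0}^k$ and $B=(B_i)_{i=0}^k$ in $(\mathbb{R}^{d\times d})^{k+1}$ let $$P_i=\begin{bmatrix}B_i&0\\0&1\end{bmatrix},\qquad Q_i=\begin{bmatrix}A_i&0\\0&0\end{bmatrix},\qquad Z_{\ell+1}=Z_\ell+\tfrac1n P_\ell Z_\ell M\,(Z_\ell^\top Q_\ell Z_\ell)\quad(0\le\ell\le k),$$ and let the in-context loss be $$f(A,B)=\mathbb{E}\Bigl[\bigl([Z_m]_{d+1,n+1}+\langle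 w_\star,x_{n+1}\rangle\bigr)^2\Bigr],$$ where $m\in\{k,k+1\}$ is the layer from which the prediction is read (the result holds for each of the two choices). Let $S$ be the set of all $(A,B)$ such that for every $i\in\{0,\dots,k\}$ there are $a_i,b_i\in\mathbb{R}$ with $A_i=a_i\Sigma^{-1}$ and $B_i=b_iI$. Then for all $A,B$ the expectation defining $f(A,B)$ is that of an integrable random variable, $f$ is differentiable in $(A,B)$, and $$\inf_{(A,B)\in S}\ \sum_{i=0}^k\Bigl(\|\nabla_{A_i}f(A,B)\|_F^2+\|\nabla_{B_i}f(A,B)\|_F^2\Bigr)=0,$$ where $\nabla_{A_i}f,\nabla_{B_i}f\in\mathbb{R}^{d\times d}$ are the gradients with respect to the Frobenius inner product on $\mathbb{R}^{d\times d}$. Moreover, the transformer with parameters $(A,B)\in S$, $A_i=a_i\Sigma^{-1}$, $B_i=b_iI$, implements the following preconditioned, covariate-transforming GD++-type algorithm, for every prompt. Write $x_j^{(\ell)}\in\mathbb{R}^d$ and $y_j^{(\ell)}\in\mathbb{R}$ for the first $d$ entries and the last entry of column $j$ of $Z_\ell$, $G_\ell=\frac1n\sum_{i=1}^n x_i^{(\ell)}x_i^{(\ell)\top}$,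 and $R_\ell(v)=\frac1{2n}\sum_{i=1}^n(\langle v,x_i^{(\ell)}\rangle-y_i^{(\ell)})^2$. Then for all $0\le\ell\le k$ and $1\le j\le n+1$, $$x_j^{(\ell+1)}=\bigl(I+a_\ell b_\ell\,G_\ell\Sigma^{-1}\bigr)x_j^{(\ell)},\qquad y_j^{(\ell+1)}=y_j^{(\ell)}-\bigl\langle a_\ell\Sigma^{-1}\nabla R_\ell(0),\,x_j^{(\ell)}\bigr\rangle .$$ -/

import Mathlib

open MeasureTheory ProbabilityTheory
open scoped Matrix Matrix.Norms.Frobenius RealInnerProductSpace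

noncomputable section

/-! Token columns are indexed by `Fin n ⊕ Unit`: `Sum.inl i` are the `n` labelled samples and
`Sum.inr ()` is the query. Token rows are indexed by `Fin d ⊕ Unit`: the `d` coordinates of the
covariate, and the response. -/

/-- A family of `K` real `d × d` matrices. -/
abbrev MatFamily (d K : ℕ) : Type := Fin K → Matrix (Fin d) (Fin d) ℝ

/-- Token matrices `Z`, of size `(d+1) × (n+1)`. -/
abbrev TokenMatrix (d n : ℕ) : Type := Matrix (Fin d ⊕ Unit) (Fin n ⊕ Unit) ℝ

/-- Weight matrices `P` and `Q`, of size `(d+1) × (d+1)`. -/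
abbrev WeightMatrix (d : ℕ) : Type := Matrix (Fin d ⊕ Unit) (Fin d ⊕ Unit) ℝ

/-- The prompt matrix `Z₀ = [x₁ ⋯ xₙ xₙ₊₁; y₁ ⋯ yₙ 0]` with `yᵢ = ⟨w, xᵢ⟩`. -/
def promptMatrix {d n : ℕ} (x : Fin n ⊕ Unit → EuclideanSpace ℝ (Fin d))
    (w : EuclideanSpace ℝ (Fin d)) : TokenMatrix d n :=
  Matrix.fromBlocks
    (Matrix.of fun p i => x (Sum.inl i) p) (Matrix.of fun p u => x (Sum.inr u) p)
    (Matrix.of fun _ i => ⟪w, x (Sum.inl i)⟫) 0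

/-- The mask `M = diag(Iₙ, 0)`. -/
def attentionMask (n : ℕ) : Matrix (Fin n ⊕ Unit) (Fin n ⊕ Unit) ℝ :=
  Matrix.fromBlocks 1 0 0 0

/-- Linear self-attention `Attn_{P,Q}(Z) = P Z M (Zᵀ Q Z)`. -/
def linearAttention {d n : ℕ} (P Q : WeightMatrix d) (Z : TokenMatrix d n) : TokenMatrix d n :=
  P * Z * attentionMask n * (Zᵀ * Q * Z)

/-- The hidden state `Z_ℓ`, where `Z_{ℓ+1} = Z_ℓ + (1/n) Attn_{P_ℓ,Q_ℓ}(Z_ℓ)`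
(used for `ℓ ≤ K` only; the state is constant after the last of the `K` layers). -/
def hiddenState {d n K : ℕ} (P Q : Fin K → WeightMatrix d) (Z : TokenMatrix d n) :
    ℕ → TokenMatrix d n
  | 0 => Z
  | l + 1 =>
    if h : l < K then
      hiddenState P Q Z l
        + (1 / (n : ℝ)) • linearAttention (P ⟨l, h⟩) (Q ⟨l, h⟩) (hiddenState P Q Z l)
    else hiddenState P Q Z l

/-- The joint law of the covariates and of the regressor: `x₁, …, xₙ₊₁` i.i.d. `N(0, Sigma)`,
and `w ~ N(0, Sigma⁻¹)` independent of them. -/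
def promptLaw {d : ℕ} (n : ℕ) (Sigma : Matrix (Fin d) (Fin d) ℝ) :
    Measure ((Fin n ⊕ Unit → EuclideanSpace ℝ (Fin d)) × EuclideanSpace ℝ (Fin d)) :=
  (Measure.pi fun _ => multivariateGaussian 0 Sigma).prod (multivariateGaussian 0 Sigma⁻¹)

/-- The squared error on one prompt when the prediction `-[Z_m]_{d+1,n+1}` is read off `Z_m`. -/
def promptError {d n K : ℕ} (m : ℕ) (P Q : Fin K → WeightMatrix d)
    (ω : (Fin n ⊕ Unit → EuclideanSpace ℝ (Fin d)) × EuclideanSpace ℝ (Fin d)) : ℝ :=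
  (hiddenState P Q (promptMatrix ω.1 ω.2) m (Sum.inr ()) (Sum.inr ())
    + ⟪ω.2, ω.1 (Sum.inr ())⟫) ^ 2

/-- The in-context loss, with the prediction read off `Z_m`. -/
def inContextLoss {d K : ℕ} (n m : ℕ) (Sigma : Matrix (Fin d) (Fin d) ℝ)
    (P Q : Fin K → WeightMatrix d) : ℝ :=
  ∫ ω, promptError (n := n) m P Q ω ∂(promptLaw n Sigma)

/-- `P_i = diag(B_i, 1)`. -/
def valueWeights {d K : ℕ} (B : MatFamily d K) (i : Fin K) : WeightMatrix d :=
  Matrix.fromBlocks (B i) 0 0 1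

/-- `Q_i = diag(A_i, 0)`. -/
def keyQueryWeights {d K : ℕ} (A : MatFamily d K) (i : Fin K) : WeightMatrix d :=
  Matrix.fromBlocks (A i) 0 0 0

/-- The loss `f(A, B)` as a function of the free parameters. -/
def paramLoss {d K : ℕ} (n m : ℕ) (Sigma : Matrix (Fin d) (Fin d) ℝ) (A B : MatFamily d K) : ℝ :=
  inContextLoss n m Sigma (valueWeights B) (keyQueryWeights A)

/-- The gradient, for the Frobenius inner product, of a function of a matrix: the matrix of its
partial derivatives (for differentiable functions). -/
def matrixGradient {d : ℕ} (g : Matrix (Fin d) (Fin d) ℝ → ℝ) (X : Matrix (Fin d) (Fin d) ℝ) :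
    Matrix (Fin d) (Fin d) ℝ :=
  Matrix.of fun p q => fderiv ℝ g X (Matrix.single p q 1)

/-- `∇_{A_i} f(A, B)`. -/
def gradA {d K : ℕ} (f : MatFamily d K → MatFamily d K → ℝ) (A B : MatFamily d K) (i : Fin K) :
    Matrix (Fin d) (Fin d) ℝ :=
  matrixGradient (fun X => f (Function.update A i X) B) (A i)

/-- `∇_{B_i} f(A, B)`. -/
def gradB {d K : ℕ} (f : MatFamily d K → MatFamily d K → ℝ) (A B : MatFamily d K) (i : Fin K) :
    Matrix (Fin d) (Fin d) ℝ :=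
  matrixGradient (fun X => f A (Function.update B i X)) (B i)

/-- `∑ᵢ ‖∇_{A_i} f(A, B)‖_F² + ‖∇_{B_i} f(A, B)‖_F²`; the norm on matrices is the Frobenius
norm. -/
def totalSqGradNorm {d K : ℕ} (f : MatFamily d K → MatFamily d K → ℝ) (A B : MatFamily d K) : ℝ :=
  ∑ i, (‖gradA f A B i‖ ^ 2 + ‖gradB f A B i‖ ^ 2)

/-- The set `S` of parameters with `A_i = a_i Sigma⁻¹` and `B_i = b_i I`. -/
def structuredParams {d : ℕ} (K : ℕ) (Sigma : Matrix (Fin d) (Fin d) ℝ) :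
    Set (MatFamily d K × MatFamily d K) :=
  {θ | ∀ i, ∃ a b : ℝ, θ.1 i = a • Sigma⁻¹ ∧ θ.2 i = b • (1 : Matrix (Fin d) (Fin d) ℝ)}

/-- The covariate stored in column `j` of a token matrix. -/
def covariate {d n : ℕ} (Z : TokenMatrix d n) (j : Fin n ⊕ Unit) : EuclideanSpace ℝ (Fin d) :=
  WithLp.toLp 2 fun p => Z (Sum.inl p) j

/-- The response stored in column `j` of a token matrix. -/
def response {d n : ℕ} (Z : TokenMatrix d n) (j : Fin n ⊕ Unit) : ℝ :=
  Z (Sum.inr ()) j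

/-- The Gram matrix `(1/n) ∑_{i ≤ n} xᵢ xᵢᵀ` of the current covariates of the labelled samples. -/
def gramMatrix {d n : ℕ} (Z : TokenMatrix d n) : Matrix (Fin d) (Fin d) ℝ :=
  (1 / (n : ℝ)) • ∑ i : Fin n, Matrix.vecMulVec (covariate Z (Sum.inl i)) (covariate Z (Sum.inl i))

/-- The least-squares loss `v ↦ (1/2n) ∑_{i ≤ n} (⟨v, xᵢ⟩ - yᵢ)²` of the current labelled
samples. -/
def leastSquares {d n : ℕ} (Z : TokenMatrix d n) (v : EuclideanSpace ℝ (Fin d)) : ℝ :=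
  (1 / (2 * (n : ℝ))) *
    ∑ i : Fin n, (⟪v, covariate Z (Sum.inl i)⟫ - response Z (Sum.inl i)) ^ 2

/-- One step of preconditioned GD++ from `Z` to `Z'`, with preconditioner `a • Sigma⁻¹`. The vector
`v = 0 + a Sigma⁻¹ ∇R(0)` is one preconditioned gradient step on the current least-squares loss
`R`, started at zero (descent when `a < 0`). Responses become the residuals `yⱼ - ⟨v, xⱼ⟩`,
and covariates are transformed by `xⱼ ↦ (I + a b G Sigma⁻¹) xⱼ`, `G` the current Gram matrix. -/
def IsPrecondGDppStep {d n : ℕ} (Sigma : Matrix (Fin d) (Fin d) ℝ) (a b : ℝ)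
    (Z Z' : TokenMatrix d n) : Prop :=
  ∀ j : Fin n ⊕ Unit,
    covariate Z' j =
        Matrix.toEuclideanLin (1 + (a * b) • (gramMatrix Z * Sigma⁻¹)) (covariate Z j) ∧
      response Z' j =
        response Z j
          - ⟪Matrix.toEuclideanLin (a • Sigma⁻¹) (gradient (leastSquares Z) 0), covariate Z j⟫

end

/-! The loss has a symmetry group that pins down the shape of its gradient on `S`. If `T * Sigma *
Tᵀ = Sigma`, the substitution `x ↦ T x`, `w ↦ T⁻ᵀ w` preserves the prompt law and every pairing `⟪w,
x⟫`. It acts on token matrices as left multiplication by `diag(T, 1)`, which can be absorbed into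
the weights, so `f(Tᵀ A T, T⁻¹ B T) = f(A, B)` (`paramLoss_change_basis`). Every point of `S` is
fixed by this action, hence the derivative of `f` there is an invariant linear functional.

Writing `Sigma = R Rᵀ`, the maps `R U R⁻¹` with `U` orthogonal are such symmetries. A functional on
matrices invariant under orthogonal conjugation is a multiple of the trace
(`card_mul_eq_trace_mul_of_orthogonal_invariant`). Transported through `R`, this makes `∇_{A_i} f` a
multiple of `Sigma` and `∇_{B_i} f` a multiple of the identity. The coefficients are the derivatives
of `f` along `Sigma⁻¹` and `I`, divided by `d`. These directions are tangent to `S`, so the full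
gradient is controlled by the derivative of `f` restricted to `S`
(`totalSqGradNorm_structuredParam_le`).

That restriction is a nonnegative differentiable function on a Euclidean space. It need not attain
its infimum, but minimising it with a small quadratic penalty yields points of arbitrarily small
derivative (`exists_norm_fderiv_lt`).

Integrability and differentiability hold because the squared error is polynomial in the parameters
with coefficients polynomial in Gaussian variables. The GD++ description is a block computation of
one attention layer. -/

/-! ### Finite sums of parameter functions times random variables with all moments. -/

/-- A random variable all of whose moments are finite. -/
def HasAllMoments {Ω : Type*} [MeasurableSpace Ω] (h : Ω → ℝ) (μ : Measure Ω) : Prop :=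
  ∀ p : ENNReal, p ≠ ⊤ → MemLp h p μ

/-- Hölder with exponents `2p, 2p, p`. Closure under products is the reason for asking for all
finite moments instead of a fixed one. -/
theorem HasAllMoments.mul {Ω : Type*} [MeasurableSpace Ω] {μ : Measure Ω} {g h : Ω → ℝ}
    (hg : HasAllMoments g μ) (hh : HasAllMoments h μ) :
    HasAllMoments (fun ω => g ω * h ω) μ := by
  intro p hp
  have hp2 : 2 * p ≠ ⊤ := ENNReal.mul_ne_top (by simp) hp
  have : ENNReal.HolderTriple (2 * p) (2 * p) p := ⟨by
    rw [ENNReal.mul_inv (by simp) (by simp), ← add_mul, ENNReal.inv_two_add_inv_two, one_mul]⟩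
  exact MemLp.mul' (hh _ hp2) (hg _ hp2)

theorem HasAllMoments.comp_measurePreserving {Ω Ω' : Type*} [MeasurableSpace Ω]
    [MeasurableSpace Ω'] {μ : Measure Ω} {ν : Measure Ω'} {h : Ω' → ℝ} (hh : HasAllMoments h ν)
    {f : Ω → Ω'} (hf : MeasurePreserving f μ ν) : HasAllMoments (fun ω => h (f ω)) μ :=
  fun p hp => (hh p hp).comp_measurePreserving hf

/-- A parametrized random variable of the form `∑ i, c i θ * h i ω`, a finite sum with
differentiable coefficients `c i` and random variables `h i` with finite moments. -/
def IsParamSeparable {Θ Ω : Type*} [NormedAddCommGroup Θ] [NormedSpace ℝ Θ] [MeasurableSpace Ω]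
    (μ : Measure Ω) (F : Θ → Ω → ℝ) : Prop :=
  ∃ (ι : Type) (_ : Fintype ι) (c : ι → Θ → ℝ) (h : ι → Ω → ℝ),
    (∀ i, Differentiable ℝ (c i)) ∧ (∀ i, HasAllMoments (h i) μ) ∧
      ∀ θ ω, F θ ω = ∑ i, c i θ * h i ω

namespace IsParamSeparable

variable {Θ Ω : Type*} [NormedAddCommGroup Θ] [NormedSpace ℝ Θ] [MeasurableSpace Ω]
  {μ : Measure Ω} {F G : Θ → Ω → ℝ}

theorem of_param [IsFiniteMeasure μ] {c : Θ → ℝ} (hc : Differentiable ℝ c) :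
    IsParamSeparable μ (fun θ _ => c θ) :=
  ⟨Unit, inferInstance, fun _ => c, fun _ _ => 1, fun _ => hc,
    fun _ _ _ => memLp_const 1, fun _ _ => by simp⟩

theorem of_random {h : Ω → ℝ} (hh : HasAllMoments h μ) :
    IsParamSeparable μ (fun (_ : Θ) ω => h ω) :=
  ⟨Unit, inferInstance, fun _ _ => 1, fun _ => h, fun _ => differentiable_const 1,
    fun _ => hh, fun _ _ => by simp⟩

theorem add (hF : IsParamSeparable μ F) (hG : IsParamSeparable μ G) :
    IsParamSeparable μ (fun θ ω => F θ ω + G θ ω) := by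
  obtain ⟨ι, _, c, h, hc, hh, hF⟩ := hF
  obtain ⟨κ, _, c', h', hc', hh', hG⟩ := hG
  refine ⟨ι ⊕ κ, inferInstance, Sum.elim c c', Sum.elim h h', ?_, ?_, fun θ ω => ?_⟩
  · rintro (i | i)
    exacts [hc i, hc' i]
  · rintro (i | i)
    exacts [hh i, hh' i]
  · simp [hF, hG]

theorem mul (hF : IsParamSeparable μ F) (hG : IsParamSeparable μ G) :
    IsParamSeparable μ (fun θ ω => F θ ω * G θ ω) := by
  obtain ⟨ι, _, c, h, hc, hh, hF⟩ := hF
  obtain ⟨κ, _, c', h', hc', hh', hG⟩ := hG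
  refine ⟨ι × κ, inferInstance, fun i θ => c i.1 θ * c' i.2 θ, fun i ω => h i.1 ω * h' i.2 ω,
    fun i => (hc i.1).mul (hc' i.2), fun i => (hh i.1).mul (hh' i.2), fun θ ω => ?_⟩
  simp only [hF, hG, Finset.sum_mul_sum, Fintype.sum_prod_type]
  exact Finset.sum_congr rfl fun i _ => Finset.sum_congr rfl fun j _ => by ring

theorem sum [IsFiniteMeasure μ] {ι : Type*} (s : Finset ι) {F : ι → Θ → Ω → ℝ}
    (hF : ∀ i, IsParamSeparable μ (F i)) : IsParamSeparable μ (fun θ ω => ∑ i ∈ s, F i θ ω) := by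
  classical
  induction s using Finset.induction_on with
  | empty => simpa using of_param (μ := μ) (differentiable_const (0 : ℝ))
  | insert i s hi ih => simpa only [Finset.sum_insert hi] using (hF i).add ih

theorem integrable (hF : IsParamSeparable μ F) (θ : Θ) : Integrable (F θ) μ := by
  obtain ⟨ι, _, c, h, -, hh, hF⟩ := hF
  rw [show F θ = fun ω => ∑ i, c i θ * h i ω from funext (hF θ)]
  exact integrable_finsetSum _ fun i _ =>
    (memLp_one_iff_integrable.1 (hh i 1 (by simp))).const_mul _

/-- Integration only replaces each `h i` by its mean, so no domination argument is needed to
differentiate. -/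
theorem differentiable_integral (hF : IsParamSeparable μ F) :
    Differentiable ℝ (fun θ => ∫ ω, F θ ω ∂μ) := by
  obtain ⟨ι, _, c, h, hc, hh, hF⟩ := hF
  have key : (fun θ => ∫ ω, F θ ω ∂μ) = fun θ => ∑ i, c i θ * ∫ ω, h i ω ∂μ := by
    funext θ
    simp_rw [hF]
    rw [integral_finsetSum _ fun i _ =>
      (memLp_one_iff_integrable.1 (hh i 1 (by simp))).const_mul _]
    simp_rw [integral_const_mul]
  rw [key]
  exact Differentiable.fun_sum fun i _ => (hc i).mul_const _

/-- Products of matrices with separable entries have separable entries. -/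
theorem matrix_mul [IsFiniteMeasure μ] {l m n : Type*} [Fintype m]
    {F : Θ → Ω → Matrix l m ℝ} {G : Θ → Ω → Matrix m n ℝ}
    (hF : ∀ i j, IsParamSeparable μ (fun θ ω => F θ ω i j))
    (hG : ∀ i j, IsParamSeparable μ (fun θ ω => G θ ω i j)) (i : l) (j : n) :
    IsParamSeparable μ (fun θ ω => (F θ ω * G θ ω) i j) := by
  simp only [Matrix.mul_apply]
  exact sum _ fun k => (hF i k).mul (hG k j)

end IsParamSeparable

/-! ### Integrability and differentiability of the loss. -/

instance isProbabilityMeasure_promptLaw {d : ℕ} (n : ℕ) (Sigma : Matrix (Fin d) (Fin d) ℝ) :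
    IsProbabilityMeasure (promptLaw n Sigma) := by
  unfold promptLaw; infer_instance

theorem hasAllMoments_eval_multivariateGaussian {d : ℕ} (μ : EuclideanSpace ℝ (Fin d))
    (S : Matrix (Fin d) (Fin d) ℝ) (p : Fin d) :
    HasAllMoments (fun x => x p) (multivariateGaussian μ S) := fun q hq =>
  (EuclideanSpace.proj p : EuclideanSpace ℝ (Fin d) →L[ℝ] ℝ).comp_memLp'
    (IsGaussian.memLp_id _ q hq)

section

variable {Θ : Type*} [NormedAddCommGroup Θ] [NormedSpace ℝ Θ] {d n K : ℕ}
  (Sigma : Matrix (Fin d) (Fin d) ℝ)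

theorem isParamSeparable_covariate (j : Fin n ⊕ Unit) (p : Fin d) :
    IsParamSeparable (promptLaw n Sigma) (fun (_ : Θ) ω => ω.1 j p) :=
  .of_random <| ((hasAllMoments_eval_multivariateGaussian _ _ p).comp_measurePreserving
    (measurePreserving_eval (fun _ : Fin n ⊕ Unit => multivariateGaussian 0 Sigma) j)
      ).comp_measurePreserving measurePreserving_fst

theorem isParamSeparable_regressor (p : Fin d) :
    IsParamSeparable (promptLaw n Sigma) (fun (_ : Θ) ω => ω.2 p) :=
  .of_random <| (hasAllMoments_eval_multivariateGaussian _ _ p).comp_measurePreserving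
    measurePreserving_snd

theorem isParamSeparable_inner (j : Fin n ⊕ Unit) :
    IsParamSeparable (promptLaw n Sigma) (fun (_ : Θ) ω => ⟪ω.2, ω.1 j⟫) := by
  simp only [PiLp.inner_apply, RCLike.inner_apply, conj_trivial]
  exact .sum _ fun p =>
    (isParamSeparable_covariate Sigma j p).mul (isParamSeparable_regressor Sigma p)

theorem isParamSeparable_promptMatrix (r : Fin d ⊕ Unit) (j : Fin n ⊕ Unit) :
    IsParamSeparable (promptLaw n Sigma) (fun (_ : Θ) ω => promptMatrix ω.1 ω.2 r j) := by
  rcases r with p | u <;> rcases j with i | u'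
  · exact isParamSeparable_covariate Sigma (Sum.inl i) p
  · exact isParamSeparable_covariate Sigma (Sum.inr u') p
  · exact isParamSeparable_inner Sigma (Sum.inl i)
  · exact .of_param (differentiable_const 0)

/-- Each layer forms entries by sums and products of earlier entries and weights, operations under
which separability is stable. -/
theorem isParamSeparable_hiddenState {P Q : Θ → Fin K → WeightMatrix d}
    (hP : ∀ i r s, Differentiable ℝ (fun θ => P θ i r s))
    (hQ : ∀ i r s, Differentiable ℝ (fun θ => Q θ i r s))
    (l : ℕ) (r : Fin d ⊕ Unit) (j : Fin n ⊕ Unit) :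
    IsParamSeparable (promptLaw n Sigma)
      (fun θ ω => hiddenState (P θ) (Q θ) (promptMatrix ω.1 ω.2) l r j) := by
  induction l generalizing r j with
  | zero => exact isParamSeparable_promptMatrix Sigma r j
  | succ l ih =>
    by_cases h : l < K
    · simp only [hiddenState, h, dif_pos, Matrix.add_apply, Matrix.smul_apply, smul_eq_mul]
      refine (ih r j).add (.mul (.of_param (differentiable_const _)) ?_)
      unfold linearAttention
      refine .matrix_mul (.matrix_mul (.matrix_mul (fun _ _ => .of_param (hP _ _ _)) ih)
        fun _ _ => .of_param (differentiable_const _)) (.matrix_mul (.matrix_mul ?_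
        fun _ _ => .of_param (hQ _ _ _)) ih) r j
      exact fun i k => ih k i
    · simpa only [hiddenState, h, dif_neg, not_false_eq_true] using ih r j

theorem isParamSeparable_promptError {P Q : Θ → Fin K → WeightMatrix d}
    (hP : ∀ i r s, Differentiable ℝ (fun θ => P θ i r s))
    (hQ : ∀ i r s, Differentiable ℝ (fun θ => Q θ i r s)) (m : ℕ) :
    IsParamSeparable (promptLaw n Sigma) (fun θ ω => promptError (n := n) m (P θ) (Q θ) ω) := by
  have h := (isParamSeparable_hiddenState (n := n) Sigma hP hQ m (Sum.inr ()) (Sum.inr ())).add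
    (isParamSeparable_inner Sigma (Sum.inr ()))
  simpa only [promptError, pow_two] using h.mul h

end

theorem differentiable_matrix_entry {d K : ℕ} (i : Fin K) (p q : Fin d) :
    Differentiable ℝ (fun A : MatFamily d K => A i p q) :=
  (LinearMap.toContinuousLinearMap ((Matrix.entryLinearMap ℝ ℝ p q).comp
    (LinearMap.proj i : MatFamily d K →ₗ[ℝ] _))).differentiable

theorem differentiable_valueWeights {d K : ℕ} (i : Fin K) (r s : Fin d ⊕ Unit) :
    Differentiable ℝ
      (fun θ : MatFamily d K × MatFamily d K => valueWeights θ.2 i r s) := by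
  rcases r with p | u <;> rcases s with q | u'
  · exact (differentiable_matrix_entry i p q).comp differentiable_snd
  all_goals exact differentiable_const _

theorem differentiable_keyQueryWeights {d K : ℕ} (i : Fin K) (r s : Fin d ⊕ Unit) :
    Differentiable ℝ
      (fun θ : MatFamily d K × MatFamily d K => keyQueryWeights θ.1 i r s) := by
  rcases r with p | u <;> rcases s with q | u'
  · exact (differentiable_matrix_entry i p q).comp differentiable_fst
  all_goals exact differentiable_const _

theorem isParamSeparable_structured_promptError {d K : ℕ} (n m : ℕ)
    (Sigma : Matrix (Fin d) (Fin d) ℝ) :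
    IsParamSeparable (promptLaw n Sigma) (fun θ : MatFamily d K × MatFamily d K =>
      promptError (n := n) m (valueWeights θ.2) (keyQueryWeights θ.1)) :=
  isParamSeparable_promptError Sigma differentiable_valueWeights differentiable_keyQueryWeights m

theorem differentiable_paramLoss {d K : ℕ} (n m : ℕ) (Sigma : Matrix (Fin d) (Fin d) ℝ) :
    Differentiable ℝ
      (fun θ : MatFamily d K × MatFamily d K => paramLoss n m Sigma θ.1 θ.2) :=
  (isParamSeparable_structured_promptError n m Sigma).differentiable_integral

/-! ### One attention layer as a GD++ step. -/

theorem gradient_leastSquares_zero {d n : ℕ} (Z : TokenMatrix d n) :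
    gradient (leastSquares Z) 0 =
      -((1 / (n : ℝ)) • ∑ i : Fin n, response Z (Sum.inl i) • covariate Z (Sum.inl i)) := by
  apply HasGradientAt.gradient
  rw [hasGradientAt_iff_hasFDerivAt]
  have h : ∀ i : Fin n, HasFDerivAt
      (fun v => (⟪v, covariate Z (Sum.inl i)⟫ - response Z (Sum.inl i)) ^ 2)
      ((2 * -response Z (Sum.inl i)) • innerSL ℝ (covariate Z (Sum.inl i))) 0 := by
    intro i
    have h1 : HasFDerivAt (fun v => ⟪v, covariate Z (Sum.inl i)⟫ - response Z (Sum.inl i))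
        (innerSL ℝ (covariate Z (Sum.inl i))) 0 := by
      simp_rw [fun v => real_inner_comm (covariate Z (Sum.inl i)) v]
      exact (innerSL ℝ (covariate Z (Sum.inl i))).hasFDerivAt.sub_const _
    simpa using h1.pow 2
  refine ((HasFDerivAt.fun_sum fun i _ => h i).const_mul (1 / (2 * (n : ℝ)))).congr_fderiv ?_
  ext v
  simp only [smul_apply, sum_apply, innerSL_apply_apply,
    InnerProductSpace.toDual_apply_apply, inner_neg_left, real_inner_smul_left, sum_inner,
    smul_eq_mul, Finset.mul_sum, ← Finset.sum_neg_distrib]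
  exact Finset.sum_congr rfl fun i _ => by
    -- For `n = 0` both prefactors vanish by the convention `1 / 0 = 0`.
    rcases eq_or_ne (n : ℝ) 0 with hn | hn
    · simp [hn]
    · field_simp

theorem mul_attentionMask_apply {d n : ℕ} (Y : TokenMatrix d n) (r : Fin d ⊕ Unit) :
    (∀ i : Fin n, (Y * attentionMask n) r (Sum.inl i) = Y r (Sum.inl i)) ∧
      ∀ u : Unit, (Y * attentionMask n) r (Sum.inr u) = 0 := by
  constructor <;> intro i <;>
    simp [Matrix.mul_apply, attentionMask, Fintype.sum_sum_type, Matrix.one_apply]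

/-- The entries of the output of one attention layer with weights `diag(B, 1)` and `diag(A, 0)`. -/
theorem linearAttention_fromBlocks_apply {d n : ℕ} (A B : Matrix (Fin d) (Fin d) ℝ)
    (Z : TokenMatrix d n) (r : Fin d ⊕ Unit) (j : Fin n ⊕ Unit) :
    linearAttention (Matrix.fromBlocks B 0 0 1) (Matrix.fromBlocks A 0 0 0) Z r j =
      ∑ i : Fin n, (Matrix.fromBlocks B 0 0 (1 : Matrix Unit Unit ℝ) * Z) r (Sum.inl i) *
        (covariate Z (Sum.inl i) ⬝ᵥ A *ᵥ covariate Z j) := by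
  rw [linearAttention, Matrix.mul_apply, Fintype.sum_sum_type]
  -- The mask removes the query column from the sum, leaving the labelled samples.
  simp only [(mul_attentionMask_apply _ r).1, (mul_attentionMask_apply _ r).2, zero_mul,
    Finset.sum_const_zero, add_zero]
  refine Finset.sum_congr rfl fun i _ => congrArg _ ?_
  rw [Matrix.mul_assoc, Matrix.mul_apply]
  simp [Matrix.mul_apply, covariate, Fintype.sum_sum_type, dotProduct, Matrix.mulVec]

/-- In the covariate rows, `(1/n) ∑ b xᵢ (xᵢᵀ a Sigma⁻¹ xⱼ)` is `a b G Sigma⁻¹ xⱼ`. In the response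
row, `(1/n) ∑ yᵢ xᵢᵀ a Sigma⁻¹ xⱼ` is minus the pairing of `a Sigma⁻¹ ∇R(0)` with `xⱼ`, since
`Sigma⁻¹` is symmetric. -/
theorem isPrecondGDppStep_linearAttention {d n : ℕ} (Sigma : Matrix (Fin d) (Fin d) ℝ)
    (hSigma : Sigma.PosDef) (a b : ℝ) (Z : TokenMatrix d n) :
    IsPrecondGDppStep Sigma a b Z
      (Z + (1 / (n : ℝ)) • linearAttention
        (Matrix.fromBlocks (b • (1 : Matrix (Fin d) (Fin d) ℝ)) 0 0 1)
        (Matrix.fromBlocks (a • Sigma⁻¹) 0 0 0) Z) := by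
  have hsymm : (Sigma⁻¹)ᵀ = Sigma⁻¹ := by
    rw [Matrix.transpose_nonsing_inv]
    exact congrArg _ hSigma.isHermitian
  intro j
  constructor
  · ext p
    have hrow : ∀ i : Fin n, (Matrix.fromBlocks (b • (1 : Matrix (Fin d) (Fin d) ℝ)) 0 0
        (1 : Matrix Unit Unit ℝ) * Z) (Sum.inl p) (Sum.inl i) = b * Z (Sum.inl p) (Sum.inl i) := by
      intro i
      simp [Matrix.mul_apply, Fintype.sum_sum_type, Matrix.one_apply]
    simp only [covariate, Matrix.add_apply, Matrix.smul_apply, linearAttention_fromBlocks_apply,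
      hrow, smul_eq_mul, Matrix.ofLp_toLpLin, Matrix.toLin'_apply, Matrix.add_mulVec,
      Matrix.one_mulVec,
      Pi.add_apply, gramMatrix, Matrix.smul_mul, Matrix.smul_mulVec, Pi.smul_apply,
      Matrix.sum_mul, Matrix.sum_mulVec, Finset.sum_apply, ← Matrix.mulVec_mulVec,
      Matrix.vecMulVec_mulVec, Finset.mul_sum, dotProduct_smul,
      op_smul_eq_smul]
    congr 1
    exact Finset.sum_congr rfl fun i _ => by ring
  · have hrow : ∀ i : Fin n, (Matrix.fromBlocks (b • (1 : Matrix (Fin d) (Fin d) ℝ)) 0 0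
        (1 : Matrix Unit Unit ℝ) * Z) (Sum.inr ()) (Sum.inl i) = Z (Sum.inr ()) (Sum.inl i) := by
      intro i
      simp [Matrix.mul_apply, Fintype.sum_sum_type]
    have hinner : ∀ x y : EuclideanSpace ℝ (Fin d),
        ⟪Matrix.toEuclideanLin (a • Sigma⁻¹) x, y⟫ = x ⬝ᵥ (a • Sigma⁻¹) *ᵥ y := by
      intro x y
      rw [EuclideanSpace.inner_eq_star_dotProduct, Matrix.ofLp_toLpLin, Matrix.toLin'_apply,
        star_trivial,
        Matrix.dotProduct_mulVec, ← Matrix.mulVec_transpose, Matrix.transpose_smul, hsymm,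
        dotProduct_comm]
    rw [gradient_leastSquares_zero, map_neg, map_smul, map_sum, inner_neg_left,
      real_inner_smul_left, sum_inner, sub_neg_eq_add]
    simp only [(Matrix.toEuclideanLin (a • Sigma⁻¹)).map_smul, real_inner_smul_left, hinner]
    simp only [response, Matrix.add_apply, Matrix.smul_apply, linearAttention_fromBlocks_apply,
      hrow, smul_eq_mul]

/-! ### Almost critical points of nonnegative functions. -/

/-- A nonnegative differentiable function has points of arbitrarily small derivative. -/
theorem exists_norm_fderiv_lt {E : Type*} [NormedAddCommGroup E] [InnerProductSpace ℝ E]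
    [FiniteDimensional ℝ E] {g : E → ℝ} (hg : Differentiable ℝ g) (hg0 : ∀ v, 0 ≤ g v)
    {δ : ℝ} (hδ : 0 < δ) : ∃ v, ‖fderiv ℝ g v‖ < δ := by
  have hpos : 0 < g 0 + 1 := by linarith [hg0 0]
  -- The penalty weight is tuned to the final estimate `(2ε‖v‖)² ≤ 4ε (g 0 + 1)`; the `+ 1` covers
  -- `g 0 = 0`.
  obtain ⟨ε, hε, hεδ⟩ : ∃ ε : ℝ, 0 < ε ∧ 4 * ε * (g 0 + 1) = δ ^ 2 :=
    ⟨δ ^ 2 / (4 * (g 0 + 1)), by positivity, by field_simp⟩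
  have hcont : Continuous fun v => g v + ε * ‖v‖ ^ 2 := by
    have := hg.continuous
    fun_prop
  have hlim : Filter.Tendsto (fun v => g v + ε * ‖v‖ ^ 2) (Filter.cocompact E) Filter.atTop :=
    Filter.tendsto_atTop_mono (fun v => le_add_of_nonneg_left (hg0 v))
      (((Filter.tendsto_pow_atTop two_ne_zero).comp
        (tendsto_norm_cocompact_atTop (E := E))).const_mul_atTop hε)
  obtain ⟨v, hv⟩ := hcont.exists_forall_le hlim
  have hd : HasFDerivAt (fun v => g v + ε * ‖v‖ ^ 2)
      (fderiv ℝ g v + ε • (2 • innerSL ℝ v)) v :=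
    (hg v).hasFDerivAt.add ((hasStrictFDerivAt_norm_sq v).hasFDerivAt.const_mul ε)
  have h0 := IsLocalMin.hasFDerivAt_eq_zero (Filter.Eventually.of_forall hv) hd
  refine ⟨v, ?_⟩
  -- The penalised minimum is compared with its value at the origin.
  have hv0 : ε * ‖v‖ ^ 2 < g 0 + 1 := by
    have := hv 0
    have := hg0 v
    simp only [norm_zero] at *
    linarith
  have hnorm : ‖fderiv ℝ g v‖ = 2 * ε * ‖v‖ := by
    rw [eq_neg_of_add_eq_zero_left h0, norm_neg, norm_smul, ← Nat.cast_smul_eq_nsmul ℝ, norm_smul,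
      innerSL_apply_norm]
    simp [abs_of_pos hε]
    ring
  rw [hnorm]
  refine lt_of_pow_lt_pow_left₀ 2 hδ.le ?_
  calc (2 * ε * ‖v‖) ^ 2 = 4 * ε * (ε * ‖v‖ ^ 2) := by ring
    _ < 4 * ε * (g 0 + 1) := by gcongr
    _ = δ ^ 2 := hεδ

/-! ### Orthogonally invariant functionals. -/

/-- A linear functional on real matrices that is invariant under conjugation by orthogonal
matrices is a multiple of the trace. -/
theorem card_mul_eq_trace_mul_of_orthogonal_invariant {ι : Type*} [Fintype ι] [DecidableEq ι]
    (L : Matrix ι ι ℝ →ₗ[ℝ] ℝ) (hL : ∀ U : Matrix ι ι ℝ, U * Uᵀ = 1 → ∀ H, L (Uᵀ * H * U) = L H)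
    (H : Matrix ι ι ℝ) : (Fintype.card ι : ℝ) * L H = H.trace * L 1 := by
  have hoff : ∀ p q, p ≠ q → L (Matrix.single p q 1) = 0 := by
    intro p q hpq
    -- Flipping the sign of coordinate `p` negates the unit matrix at `(p, q)`.
    have h := hL (Matrix.diagonal fun i => if i = p then -1 else 1) (by
      rw [Matrix.diagonal_transpose, Matrix.diagonal_mul_diagonal, ← Matrix.diagonal_one]
      congr 1
      ext i
      split_ifs <;> simp) (Matrix.single p q 1)
    have h' : (Matrix.diagonal fun i => if i = p then (-1 : ℝ) else 1)ᵀ * Matrix.single p q 1 *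
        (Matrix.diagonal fun i => if i = p then -1 else 1) = -Matrix.single p q 1 := by
      ext i j
      simp only [Matrix.diagonal_transpose, Matrix.mul_diagonal, Matrix.diagonal_mul,
        Matrix.neg_apply, Matrix.single_apply]
      by_cases hi : p = i <;> by_cases hj : q = j <;> simp [hi, hj]
      subst hi hj
      simp [hpq.symm]
    rw [h', map_neg] at h
    linarith
  have hdiag : ∀ p q, L (Matrix.single p p 1) = L (Matrix.single q q 1) := by
    intro p q
    -- Swapping coordinates `p` and `q` exchanges the two diagonal unit matrices.
    have h := hL ((Equiv.swap p q).toPEquiv.toMatrix) (by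
      rw [← PEquiv.toMatrix_symm, ← PEquiv.toMatrix_trans, ← Equiv.toPEquiv_symm,
        ← Equiv.toPEquiv_trans]
      simp) (Matrix.single p p 1)
    have h' : ((Equiv.swap p q).toPEquiv.toMatrix : Matrix ι ι ℝ)ᵀ * Matrix.single p p 1 *
        (Equiv.swap p q).toPEquiv.toMatrix = Matrix.single q q 1 := by
      rw [← PEquiv.toMatrix_symm, ← Equiv.toPEquiv_symm, PEquiv.toMatrix_toPEquiv_mul,
        PEquiv.mul_toMatrix_toPEquiv]
      ext i j
      simp [Matrix.single_apply, Equiv.swap_apply_def]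
      grind
    rw [← h, h']
  have hsum : ∀ p, (Fintype.card ι : ℝ) * L (Matrix.single p p 1) = L 1 := by
    intro p
    have : (1 : Matrix ι ι ℝ) = ∑ q, Matrix.single q q 1 := by
      conv_lhs => rw [Matrix.matrix_eq_sum_single 1]
      refine Finset.sum_congr rfl fun q _ => ?_
      rw [Finset.sum_eq_single q] <;> simp +contextual [eq_comm]
    rw [this, map_sum, Finset.sum_congr rfl fun q _ => hdiag q p]
    simp
  have hLH : L H = ∑ p, H p p * L (Matrix.single p p 1) := by
    conv_lhs => rw [Matrix.matrix_eq_sum_single H]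
    simp only [map_sum]
    refine Finset.sum_congr rfl fun p _ => ?_
    have hs : ∀ q, L (Matrix.single p q (H p q)) = H p q * L (Matrix.single p q 1) := fun q => by
      rw [← smul_eq_mul, ← map_smul, Matrix.smul_single, smul_eq_mul, mul_one]
    rw [Finset.sum_eq_single p, hs]
    · intro q _ hq
      rw [hs, hoff p q hq.symm, mul_zero]
    · simp
  rw [hLH, Matrix.trace, Finset.mul_sum, Finset.sum_mul]
  refine Finset.sum_congr rfl fun p _ => ?_
  rw [← hsum p, Matrix.diag_apply]
  ring

/-! ### Symmetries of the prompt law and of the loss. -/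

/-- A centred Gaussian law is invariant under the linear maps that preserve its covariance. -/
theorem measurePreserving_toEuclideanCLM_multivariateGaussian {d : ℕ}
    {S T : Matrix (Fin d) (Fin d) ℝ} (hS : S.PosSemidef) (hT : T * S * Tᵀ = S) :
    MeasurePreserving (Matrix.toEuclideanCLM (𝕜 := ℝ) T)
      (multivariateGaussian 0 S) (multivariateGaussian 0 S) := by
  refine ⟨by fun_prop, ?_⟩
  apply Measure.ext_of_charFun
  ext t
  have hadj : ∀ x : EuclideanSpace ℝ (Fin d), ⟪Matrix.toEuclideanCLM (𝕜 := ℝ) T x, t⟫ =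
      ⟪x, Matrix.toEuclideanCLM (𝕜 := ℝ) Tᵀ t⟫ := fun x => by
    rw [real_inner_comm, Matrix.inner_toEuclideanCLM, Matrix.inner_toEuclideanCLM,
      Matrix.mulVec_transpose, Matrix.dotProduct_mulVec, dotProduct_comm]
  rw [charFun_apply, integral_map (by fun_prop) (by fun_prop)]
  simp_rw [hadj]
  rw [← charFun_apply, charFun_multivariateGaussian hS, charFun_multivariateGaussian hS]
  have hq : (Matrix.toEuclideanCLM (𝕜 := ℝ) Tᵀ t).ofLp ⬝ᵥ S *ᵥ
      (Matrix.toEuclideanCLM (𝕜 := ℝ) Tᵀ t).ofLp = t.ofLp ⬝ᵥ S *ᵥ t.ofLp := by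
    conv_rhs => rw [← hT]
    rw [Matrix.ofLp_toEuclideanCLM, Matrix.mulVec_transpose, ← Matrix.dotProduct_mulVec,
      ← Matrix.mulVec_transpose, Matrix.mulVec_mulVec, Matrix.mulVec_mulVec, Matrix.mul_assoc]
  rw [hq]
  simp

/-- The prompt law is invariant under the simultaneous change of coordinates `x ↦ T x` and
`w ↦ T⁻ᵀ w` if `T` preserves the covariance of the covariates. -/
theorem measurePreserving_promptLaw {d : ℕ} (n : ℕ) {Sigma T : Matrix (Fin d) (Fin d) ℝ}
    (hSigma : Sigma.PosDef) (hT : T * Sigma * Tᵀ = Sigma) :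
    MeasurePreserving
      (Prod.map (fun (x : Fin n ⊕ Unit → EuclideanSpace ℝ (Fin d)) j =>
        Matrix.toEuclideanCLM (𝕜 := ℝ) T (x j)) (Matrix.toEuclideanCLM (𝕜 := ℝ) T⁻¹ᵀ))
      (promptLaw n Sigma) (promptLaw n Sigma) := by
  refine MeasurePreserving.prod (measurePreserving_pi _ _ fun _ =>
    measurePreserving_toEuclideanCLM_multivariateGaussian hSigma.posSemidef hT)
    (measurePreserving_toEuclideanCLM_multivariateGaussian hSigma.inv.posSemidef ?_)
  -- Inverting `T Sigma Tᵀ = Sigma` shows that `T⁻ᵀ` preserves `Sigma⁻¹`.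
  conv_rhs => rw [← hT]
  rw [Matrix.mul_inv_rev, Matrix.mul_inv_rev, Matrix.transpose_transpose,
    Matrix.transpose_nonsing_inv, Matrix.mul_assoc]

/-- Equivariance of the hidden states under a change of basis of the token space. -/
theorem hiddenState_mul {d n K : ℕ} {D D' : WeightMatrix d} (hD : D * D' = 1)
    (P Q : Fin K → WeightMatrix d) (Z : TokenMatrix d n) (l : ℕ) :
    hiddenState P Q (D * Z) l =
      D * hiddenState (fun i => D' * P i * D) (fun i => Dᵀ * Q i * D) Z l := by
  induction l with
  | zero => rfl
  | succ l ih =>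
    by_cases h : l < K
    · simp only [hiddenState, h, dif_pos, ih, Matrix.mul_add, Matrix.mul_smul, linearAttention,
        Matrix.transpose_mul]
      -- Inserting `D * D'` in front of `P` pulls `D` out of the attention term.
      have : ∀ X : TokenMatrix d n, D * (D' * X) = X := fun X => by
        rw [← Matrix.mul_assoc, hD, Matrix.one_mul]
      simp only [Matrix.mul_assoc, this]
    · simpa only [hiddenState, h, dif_neg, not_false_eq_true] using ih

/-- The pairings with `w` are unchanged, so the new prompt is `diag(T, 1)` times the old one. This
factor passes through all layers and leaves the last row, hence the prediction, untouched. -/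
theorem promptError_change_basis {d n K : ℕ} {T : Matrix (Fin d) (Fin d) ℝ}
    (hT : T * T⁻¹ = 1) (m : ℕ) (A B : MatFamily d K)
    (ω : (Fin n ⊕ Unit → EuclideanSpace ℝ (Fin d)) × EuclideanSpace ℝ (Fin d)) :
    promptError m (valueWeights B) (keyQueryWeights A)
        (Prod.map (fun (x : Fin n ⊕ Unit → EuclideanSpace ℝ (Fin d)) j =>
          Matrix.toEuclideanCLM (𝕜 := ℝ) T (x j)) (Matrix.toEuclideanCLM (𝕜 := ℝ) T⁻¹ᵀ) ω) =
      promptError m (valueWeights fun i => T⁻¹ * B i * T)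
        (keyQueryWeights fun i => Tᵀ * A i * T) ω := by
  obtain ⟨x, w⟩ := ω
  have hinner : ∀ j, ⟪Matrix.toEuclideanCLM (𝕜 := ℝ) T⁻¹ᵀ w,
      Matrix.toEuclideanCLM (𝕜 := ℝ) T (x j)⟫ = ⟪w, x j⟫ := fun j => by
    rw [Matrix.inner_toEuclideanCLM, Matrix.ofLp_toEuclideanCLM, Matrix.mulVec_transpose,
      ← Matrix.dotProduct_mulVec, Matrix.mulVec_mulVec, mul_eq_one_comm.1 hT,
      Matrix.one_mulVec, EuclideanSpace.inner_eq_star_dotProduct, star_trivial, dotProduct_comm]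
  have hZ : promptMatrix (fun j => Matrix.toEuclideanCLM (𝕜 := ℝ) T (x j))
      (Matrix.toEuclideanCLM (𝕜 := ℝ) T⁻¹ᵀ w) =
        (Matrix.fromBlocks T 0 0 1 : WeightMatrix d) * promptMatrix x w := by
    rw [promptMatrix, promptMatrix, Matrix.fromBlocks_multiply]
    simp only [hinner, Matrix.zero_mul, Matrix.mul_zero, Matrix.one_mul, add_zero, zero_add]
    congr 1
  have hD : (Matrix.fromBlocks T 0 0 1 : WeightMatrix d) * Matrix.fromBlocks T⁻¹ 0 0 1 = 1 := by
    simp [Matrix.fromBlocks_multiply, hT]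
  have hB : (fun i => (Matrix.fromBlocks T⁻¹ 0 0 1 : WeightMatrix d) * valueWeights B i *
      Matrix.fromBlocks T 0 0 1) = valueWeights fun i => T⁻¹ * B i * T := by
    funext i
    simp [valueWeights, Matrix.fromBlocks_multiply]
  have hA : (fun i => (Matrix.fromBlocks T 0 0 1 : WeightMatrix d)ᵀ * keyQueryWeights A i *
      Matrix.fromBlocks T 0 0 1) = keyQueryWeights fun i => Tᵀ * A i * T := by
    funext i
    simp [keyQueryWeights, Matrix.fromBlocks_multiply, Matrix.fromBlocks_transpose]
  simp only [promptError, Prod.map, hinner, hZ, hiddenState_mul hD, hA, hB]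
  simp [Matrix.mul_apply, Fintype.sum_sum_type]

theorem paramLoss_change_basis {d K : ℕ} (n m : ℕ) {Sigma T : Matrix (Fin d) (Fin d) ℝ}
    (hSigma : Sigma.PosDef) (hT : T * Sigma * Tᵀ = Sigma) (hT' : T * T⁻¹ = 1)
    (A B : MatFamily d K) :
    paramLoss n m Sigma (fun i => Tᵀ * A i * T) (fun i => T⁻¹ * B i * T) =
      paramLoss n m Sigma A B := by
  have hmp := measurePreserving_promptLaw n hSigma hT
  have hint := (isParamSeparable_structured_promptError n m Sigma).integrable (A, B)
  rw [paramLoss, inContextLoss, paramLoss, inContextLoss]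
  conv_rhs => rw [← hmp.map_eq]
  rw [integral_map hmp.aemeasurable (by rw [hmp.map_eq]; exact hint.aestronglyMeasurable)]
  simp_rw [promptError_change_basis hT']

theorem exists_mul_transpose_eq_of_posDef {d : ℕ} {Sigma : Matrix (Fin d) (Fin d) ℝ}
    (hSigma : Sigma.PosDef) :
    ∃ R : Matrix (Fin d) (Fin d) ℝ, R * Rᵀ = Sigma ∧ R * R⁻¹ = 1 ∧ R⁻¹ * R = 1 := by
  obtain ⟨R, hR⟩ : ∃ R : Matrix (Fin d) (Fin d) ℝ, R * Rᵀ = Sigma := by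
    open scoped MatrixOrder in
    obtain ⟨s, hs⟩ := CStarAlgebra.nonneg_iff_eq_star_mul_self.1 hSigma.posSemidef.nonneg
    -- Over the reals the star of a matrix is its transpose, so `R = sᵀ` gives `R Rᵀ = star s * s`.
    exact ⟨sᵀ, by rw [hs, Matrix.transpose_transpose]; rfl⟩
  have hdet : IsUnit R.det := by
    refine isUnit_iff_ne_zero.2 fun h => hSigma.det_pos.ne' ?_
    rw [← hR, Matrix.det_mul, h, zero_mul]
  exact ⟨R, hR, Matrix.mul_nonsing_inv R hdet, Matrix.nonsing_inv_mul R hdet⟩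

/-- The maps `R U R⁻¹`, `U` orthogonal, preserve `R Rᵀ`. -/
theorem orthogonal_conj_preserves {d : ℕ} {R U : Matrix (Fin d) (Fin d) ℝ}
    (hR : R⁻¹ * R = 1) (hU : U * Uᵀ = 1) :
    (R * U * R⁻¹) * (R * Rᵀ) * (R * U * R⁻¹)ᵀ = R * Rᵀ := by
  calc (R * U * R⁻¹) * (R * Rᵀ) * (R * U * R⁻¹)ᵀ
      = R * (U * ((R⁻¹ * R) * ((R⁻¹ * R)ᵀ * Uᵀ))) * Rᵀ := by
        simp only [Matrix.transpose_mul, Matrix.mul_assoc]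
    _ = R * Rᵀ := by
        rw [hR, Matrix.transpose_one, Matrix.one_mul, Matrix.one_mul, hU, Matrix.mul_one]

theorem orthogonal_conj_mul {d : ℕ} {R U : Matrix (Fin d) (Fin d) ℝ}
    (hR : R * R⁻¹ = 1) (hR' : R⁻¹ * R = 1) (hU : U * Uᵀ = 1) :
    R * U * R⁻¹ * (R * Uᵀ * R⁻¹) = 1 := by
  calc R * U * R⁻¹ * (R * Uᵀ * R⁻¹) = R * (U * ((R⁻¹ * R) * Uᵀ)) * R⁻¹ := by
        simp only [Matrix.mul_assoc]
    _ = 1 := by rw [hR', Matrix.one_mul, hU, Matrix.mul_one, hR]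

/-- The functional `H ↦ L (R⁻ᵀ H R⁻¹)` is orthogonally invariant, by the hypothesis at `T = R U
R⁻¹`, so it is a multiple of the trace. Evaluating it at `Rᵀ H R` and at `1` returns `L H` and `L
Sigma⁻¹`. -/
theorem mul_apply_eq_of_congruence_invariant {d : ℕ} {Sigma : Matrix (Fin d) (Fin d) ℝ}
    (hSigma : Sigma.PosDef) (L : Matrix (Fin d) (Fin d) ℝ →ₗ[ℝ] ℝ)
    (hL : ∀ T : Matrix (Fin d) (Fin d) ℝ, T * Sigma * Tᵀ = Sigma → T * T⁻¹ = 1 →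
      ∀ H, L (Tᵀ * H * T) = L H) (H : Matrix (Fin d) (Fin d) ℝ) :
    (d : ℝ) * L H = (Sigma * H).trace * L Sigma⁻¹ := by
  obtain ⟨R, rfl, hR, hR'⟩ := exists_mul_transpose_eq_of_posDef hSigma
  have hRt : Rᵀ * R⁻¹ᵀ = 1 := by rw [← Matrix.transpose_mul, hR', Matrix.transpose_one]
  have hRt' : R⁻¹ᵀ * Rᵀ = 1 := by rw [← Matrix.transpose_mul, hR, Matrix.transpose_one]
  have key := card_mul_eq_trace_mul_of_orthogonal_invariant
    (L ∘ₗ LinearMap.mulLeft ℝ R⁻¹ᵀ ∘ₗ LinearMap.mulRight ℝ R⁻¹) (fun U hU H => ?_) (Rᵀ * H * R)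
  · simp only [LinearMap.comp_apply, LinearMap.mulLeft_apply, LinearMap.mulRight_apply,
      Fintype.card_fin, Matrix.one_mul] at key
    rw [Matrix.mul_inv_rev, ← Matrix.transpose_nonsing_inv, Matrix.mul_assoc R,
      Matrix.trace_mul_comm R, ← key]
    congr 2
    rw [Matrix.mul_assoc (Rᵀ * H), hR, Matrix.mul_one, ← Matrix.mul_assoc, hRt', Matrix.one_mul]
  · simp only [LinearMap.comp_apply, LinearMap.mulLeft_apply, LinearMap.mulRight_apply]
    have hT := orthogonal_conj_mul hR hR' hU
    have hTinv := Matrix.inv_eq_right_inv hT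
    refine Eq.trans (congrArg L ?_) (hL _ (orthogonal_conj_preserves hR' hU)
      (by rw [hTinv, hT]) (R⁻¹ᵀ * (H * R⁻¹)))
    simp only [Matrix.transpose_mul, Matrix.mul_assoc]
    simp only [← Matrix.mul_assoc Rᵀ, hRt, ← Matrix.mul_assoc R⁻¹ R, hR', Matrix.one_mul]

/-- Same transport, with `H ↦ L (R H R⁻¹)` evaluated at `R⁻¹ H R`. -/
theorem mul_apply_eq_of_similarity_invariant {d : ℕ} {Sigma : Matrix (Fin d) (Fin d) ℝ}
    (hSigma : Sigma.PosDef) (L : Matrix (Fin d) (Fin d) ℝ →ₗ[ℝ] ℝ)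
    (hL : ∀ T : Matrix (Fin d) (Fin d) ℝ, T * Sigma * Tᵀ = Sigma → T * T⁻¹ = 1 →
      ∀ H, L (T⁻¹ * H * T) = L H) (H : Matrix (Fin d) (Fin d) ℝ) :
    (d : ℝ) * L H = H.trace * L 1 := by
  obtain ⟨R, rfl, hR, hR'⟩ := exists_mul_transpose_eq_of_posDef hSigma
  have key := card_mul_eq_trace_mul_of_orthogonal_invariant
    (L ∘ₗ LinearMap.mulLeft ℝ R ∘ₗ LinearMap.mulRight ℝ R⁻¹) (fun U hU H => ?_) (R⁻¹ * H * R)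
  · simp only [LinearMap.comp_apply, LinearMap.mulLeft_apply, LinearMap.mulRight_apply,
      Fintype.card_fin, Matrix.one_mul, hR] at key
    have hH : R * (R⁻¹ * H * R * R⁻¹) = H := by
      rw [Matrix.mul_assoc, hR, Matrix.mul_one, ← Matrix.mul_assoc, hR, Matrix.one_mul]
    have htr : (R⁻¹ * H * R).trace = H.trace := by
      rw [Matrix.trace_mul_comm, ← Matrix.mul_assoc, hR, Matrix.one_mul]
    rwa [hH, htr] at key
  · simp only [LinearMap.comp_apply, LinearMap.mulLeft_apply, LinearMap.mulRight_apply]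
    have hT := orthogonal_conj_mul hR hR' hU
    have hTinv := Matrix.inv_eq_right_inv hT
    refine Eq.trans (congrArg L ?_) (hL _ (orthogonal_conj_preserves hR' hU)
      (by rw [hTinv, hT]) (R * (H * R⁻¹)))
    rw [hTinv]
    simp only [Matrix.mul_assoc]
    simp only [← Matrix.mul_assoc R⁻¹ R, hR', Matrix.one_mul]

/-! ### Shape of the gradient at structured parameters. -/

/-- The map `M ↦ X M Y` on every member of a family of matrices. -/
def conjFamily {d K : ℕ} (X Y : Matrix (Fin d) (Fin d) ℝ) : MatFamily d K →ₗ[ℝ] MatFamily d K :=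
  LinearMap.pi fun i => (LinearMap.mulLeft ℝ X ∘ₗ LinearMap.mulRight ℝ Y) ∘ₗ LinearMap.proj i

theorem conjFamily_apply {d K : ℕ} (X Y : Matrix (Fin d) (Fin d) ℝ) (A : MatFamily d K) :
    conjFamily X Y A = fun i => X * A i * Y := by
  funext i
  simp [conjFamily, Matrix.mul_assoc]

theorem conjFamily_single {d K : ℕ} (X Y : Matrix (Fin d) (Fin d) ℝ) (i : Fin K)
    (H : Matrix (Fin d) (Fin d) ℝ) :
    conjFamily X Y (Pi.single i H) = Pi.single i (X * H * Y) := by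
  rw [conjFamily_apply]
  funext j
  rcases eq_or_ne j i with rfl | h
  · simp
  · simp [h]

section

variable {d K : ℕ} {F : MatFamily d K × MatFamily d K → ℝ}

/-- Expresses the blockwise gradient through the joint derivative, on which the symmetry acts. -/
theorem gradA_apply (hF : Differentiable ℝ F) (A B : MatFamily d K) (i : Fin K) (p q : Fin d) :
    gradA (fun A B => F (A, B)) A B i p q =
      fderiv ℝ F (A, B) (Pi.single i (Matrix.single p q 1), 0) := by
  have h : HasFDerivAt (fun X => (Function.update A i X, B))
      ((ContinuousLinearMap.pi (Pi.single i (.id ℝ (Matrix (Fin d) (Fin d) ℝ)))).prod 0) (A i) :=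
    (hasFDerivAt_update A (A i)).prodMk (hasFDerivAt_const B (A i))
  have hF' : HasFDerivAt F (fderiv ℝ F (A, B)) (Function.update A i (A i), B) := by
    rw [Function.update_eq_self]
    exact (hF _).hasFDerivAt
  refine (DFunLike.congr_fun (HasFDerivAt.fderiv (f := fun X => F (Function.update A i X, B))
    (hF'.comp (A i) h)) (Matrix.single p q 1)).trans ?_
  refine congrArg (fderiv ℝ F (A, B)) (Prod.ext (funext fun j => ?_) rfl)
  change (Pi.single i (.id ℝ (Matrix (Fin d) (Fin d) ℝ)) :
    Fin K → Matrix (Fin d) (Fin d) ℝ →L[ℝ] Matrix (Fin d) (Fin d) ℝ) j _ =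
      Pi.single (M := fun _ => Matrix (Fin d) (Fin d) ℝ) i _ j
  rcases eq_or_ne j i with rfl | h
  · simp
  · simp [h]

theorem gradB_apply (hF : Differentiable ℝ F) (A B : MatFamily d K) (i : Fin K) (p q : Fin d) :
    gradB (fun A B => F (A, B)) A B i p q =
      fderiv ℝ F (A, B) (0, Pi.single i (Matrix.single p q 1)) := by
  have h : HasFDerivAt (fun X => (A, Function.update B i X))
      ((0 : Matrix (Fin d) (Fin d) ℝ →L[ℝ] MatFamily d K).prod
        (ContinuousLinearMap.pi (Pi.single i (.id ℝ (Matrix (Fin d) (Fin d) ℝ))))) (B i) :=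
    (hasFDerivAt_const A (B i)).prodMk (hasFDerivAt_update B (B i))
  have hF' : HasFDerivAt F (fderiv ℝ F (A, B)) (A, Function.update B i (B i)) := by
    rw [Function.update_eq_self]
    exact (hF _).hasFDerivAt
  refine (DFunLike.congr_fun (HasFDerivAt.fderiv (f := fun X => F (A, Function.update B i X))
    (hF'.comp (B i) h)) (Matrix.single p q 1)).trans ?_
  refine congrArg (fderiv ℝ F (A, B)) (Prod.ext rfl (funext fun j => ?_))
  change (Pi.single i (.id ℝ (Matrix (Fin d) (Fin d) ℝ)) :
    Fin K → Matrix (Fin d) (Fin d) ℝ →L[ℝ] Matrix (Fin d) (Fin d) ℝ) j _ =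
      Pi.single (M := fun _ => Matrix (Fin d) (Fin d) ℝ) i _ j
  rcases eq_or_ne j i with rfl | h
  · simp
  · simp [h]

/-- The derivative of a function at a fixed point of a linear symmetry is invariant under it. -/
theorem fderiv_apply_eq_of_comp_eq {E : Type*} [NormedAddCommGroup E] [NormedSpace ℝ E]
    {f : E → ℝ} (hf : Differentiable ℝ f) (Φ : E →L[ℝ] E) (hΦ : ∀ x, f (Φ x) = f x) {x : E}
    (hx : Φ x = x) (v : E) : fderiv ℝ f x (Φ v) = fderiv ℝ f x v := by
  have h1 : HasFDerivAt f (fderiv ℝ f x) (Φ x) := by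
    rw [hx]
    exact (hf x).hasFDerivAt
  have h2 := h1.comp x Φ.hasFDerivAt
  rw [show f ∘ Φ = f from funext hΦ] at h2
  conv_rhs => rw [h2.fderiv]
  rfl

end

/-- The action fixes structured parameters: `Tᵀ Sigma⁻¹ T = Sigma⁻¹` and `T⁻¹ I T = I`. -/
theorem fderiv_paramLoss_change_basis {d K : ℕ} (n m : ℕ) {Sigma T : Matrix (Fin d) (Fin d) ℝ}
    (hSigma : Sigma.PosDef) (hT : T * Sigma * Tᵀ = Sigma) (hT' : T * T⁻¹ = 1)
    {θ : MatFamily d K × MatFamily d K} (hθ : θ ∈ structuredParams K Sigma)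
    (V W : MatFamily d K) :
    fderiv ℝ (fun θ : MatFamily d K × MatFamily d K => paramLoss n m Sigma θ.1 θ.2) θ
        (conjFamily Tᵀ T V, conjFamily T⁻¹ T W) =
      fderiv ℝ (fun θ : MatFamily d K × MatFamily d K => paramLoss n m Sigma θ.1 θ.2) θ (V, W) := by
  have hinv : Tᵀ * Sigma⁻¹ * T = Sigma⁻¹ := by
    have hT'' : T⁻¹ * T = 1 := mul_eq_one_comm.1 hT'
    have ht : Tᵀ * T⁻¹ᵀ = 1 := by rw [← Matrix.transpose_mul, hT'', Matrix.transpose_one]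
    conv_lhs => rw [← hT, Matrix.mul_inv_rev, Matrix.mul_inv_rev, ← Matrix.transpose_nonsing_inv]
    rw [← Matrix.mul_assoc, ht, Matrix.one_mul, Matrix.mul_assoc, hT'', Matrix.mul_one]
  refine fderiv_apply_eq_of_comp_eq (differentiable_paramLoss n m Sigma)
    (LinearMap.toContinuousLinearMap ((conjFamily Tᵀ T).prodMap (conjFamily T⁻¹ T)))
    (fun ϑ => ?_) ?_ (V, W)
  · simp only [LinearMap.coe_toContinuousLinearMap', LinearMap.prodMap_apply, conjFamily_apply]
    exact paramLoss_change_basis n m hSigma hT hT' _ _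
  · simp only [LinearMap.coe_toContinuousLinearMap', LinearMap.prodMap_apply, conjFamily_apply]
    ext1
    · funext i
      obtain ⟨a, -, ha, -⟩ := hθ i
      simp only [ha, Matrix.mul_smul, Matrix.smul_mul, hinv]
    · funext i
      obtain ⟨-, b, -, hb⟩ := hθ i
      simp only [hb, Matrix.mul_smul, Matrix.smul_mul, Matrix.mul_one, mul_eq_one_comm.1 hT']

/-- At a structured parameter, `∇_{A_i} f` is a multiple of `Sigma`. -/
theorem gradA_paramLoss_eq {d K : ℕ} (n m : ℕ) {Sigma : Matrix (Fin d) (Fin d) ℝ}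
    (hSigma : Sigma.PosDef) {θ : MatFamily d K × MatFamily d K}
    (hθ : θ ∈ structuredParams K Sigma) (i : Fin K) :
    gradA (paramLoss n m Sigma) θ.1 θ.2 i =
      (fderiv ℝ (fun θ : MatFamily d K × MatFamily d K => paramLoss n m Sigma θ.1 θ.2) θ
        (Pi.single i Sigma⁻¹, 0) / d) • Sigma := by
  ext p q
  -- An entry index exists, so `d ≠ 0`; for `d = 0` there is nothing to check.
  have hd : (d : ℝ) ≠ 0 := Nat.cast_ne_zero.2 (Fin.pos p).ne'
  have h := mul_apply_eq_of_congruence_invariant hSigma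
    ((fderiv ℝ (fun θ : MatFamily d K × MatFamily d K => paramLoss n m Sigma θ.1 θ.2) θ) ∘ₗ
      LinearMap.inl ℝ _ (MatFamily d K) ∘ₗ
        LinearMap.single ℝ (fun _ : Fin K => Matrix (Fin d) (Fin d) ℝ) i) (fun T hT hT' H => ?_)
    (Matrix.single p q 1)
  · simp only [LinearMap.comp_apply, LinearMap.coe_single, LinearMap.inl_apply,
      ContinuousLinearMap.coe_coe, Matrix.trace_mul_single, MulOpposite.op_one, one_smul] at h
    rw [gradA_apply (differentiable_paramLoss n m Sigma), Matrix.smul_apply, smul_eq_mul,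
      div_mul_eq_mul_div, eq_div_iff hd, mul_comm, h, mul_comm]
    congr 1
    exact congrFun (congrFun hSigma.isHermitian p) q
  · simpa [conjFamily_single] using
      fderiv_paramLoss_change_basis n m hSigma hT hT' hθ (Pi.single i H) 0

/-- At a structured parameter, `∇_{B_i} f` is a multiple of the identity. -/
theorem gradB_paramLoss_eq {d K : ℕ} (n m : ℕ) {Sigma : Matrix (Fin d) (Fin d) ℝ}
    (hSigma : Sigma.PosDef) {θ : MatFamily d K × MatFamily d K}
    (hθ : θ ∈ structuredParams K Sigma) (i : Fin K) :
    gradB (paramLoss n m Sigma) θ.1 θ.2 i =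
      (fderiv ℝ (fun θ : MatFamily d K × MatFamily d K => paramLoss n m Sigma θ.1 θ.2) θ
        (0, Pi.single i 1) / d) • (1 : Matrix (Fin d) (Fin d) ℝ) := by
  ext p q
  have hd : (d : ℝ) ≠ 0 := Nat.cast_ne_zero.2 (Fin.pos p).ne'
  have h := mul_apply_eq_of_similarity_invariant hSigma
    ((fderiv ℝ (fun θ : MatFamily d K × MatFamily d K => paramLoss n m Sigma θ.1 θ.2) θ) ∘ₗ
      LinearMap.inr ℝ (MatFamily d K) _ ∘ₗ
        LinearMap.single ℝ (fun _ : Fin K => Matrix (Fin d) (Fin d) ℝ) i) (fun T hT hT' H => ?_)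
    (Matrix.single p q 1)
  · simp only [LinearMap.comp_apply, LinearMap.coe_single, LinearMap.inr_apply,
      ContinuousLinearMap.coe_coe] at h
    rw [gradB_apply (differentiable_paramLoss n m Sigma), Matrix.smul_apply, smul_eq_mul,
      div_mul_eq_mul_div, eq_div_iff hd, mul_comm, h, mul_comm]
    congr 1
    rcases eq_or_ne p q with rfl | hpq
    · simp
    · simp [hpq, Matrix.trace_single_eq_of_ne]
  · simpa [conjFamily_single] using
      fderiv_paramLoss_change_basis n m hSigma hT hT' hθ 0 (Pi.single i H)

/-! ### Restriction to the structured parameters and conclusion. -/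

/-- The structured parameter `A_i = u_i Sigma⁻¹`, `B_i = v_i I`. -/
noncomputable def structuredParam {d : ℕ} (K : ℕ) (Sigma : Matrix (Fin d) (Fin d) ℝ) :
    EuclideanSpace ℝ (Fin K ⊕ Fin K) →ₗ[ℝ] MatFamily d K × MatFamily d K where
  toFun u := (fun i => u (Sum.inl i) • Sigma⁻¹, fun i => u (Sum.inr i) • 1)
  map_add' u v := by ext <;> simp [add_mul]
  map_smul' c u := by ext <;> simp [mul_assoc]

theorem structuredParam_mem {d K : ℕ} (Sigma : Matrix (Fin d) (Fin d) ℝ)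
    (u : EuclideanSpace ℝ (Fin K ⊕ Fin K)) :
    structuredParam K Sigma u ∈ structuredParams K Sigma :=
  fun i => ⟨u (Sum.inl i), u (Sum.inr i), rfl, rfl⟩

theorem structuredParam_single_inl {d K : ℕ} (Sigma : Matrix (Fin d) (Fin d) ℝ) (i : Fin K) :
    structuredParam K Sigma (EuclideanSpace.single (Sum.inl i) 1) = (Pi.single i Sigma⁻¹, 0) := by
  refine Prod.ext (funext fun j => ?_) (funext fun j => ?_)
  · rcases eq_or_ne j i with rfl | h <;> simp [structuredParam, *]
  · simp [structuredParam]

theorem structuredParam_single_inr {d K : ℕ} (Sigma : Matrix (Fin d) (Fin d) ℝ) (i : Fin K) :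
    structuredParam K Sigma (EuclideanSpace.single (Sum.inr i) 1) = (0, Pi.single i 1) := by
  refine Prod.ext (funext fun j => ?_) (funext fun j => ?_)
  · simp [structuredParam]
  · rcases eq_or_ne j i with rfl | h <;> simp [structuredParam, *]

theorem totalSqGradNorm_nonneg {d K : ℕ} (f : MatFamily d K → MatFamily d K → ℝ)
    (A B : MatFamily d K) : 0 ≤ totalSqGradNorm f A B :=
  Finset.sum_nonneg fun _ _ => by positivity

theorem paramLoss_nonneg {d K : ℕ} (n m : ℕ) (Sigma : Matrix (Fin d) (Fin d) ℝ)
    (A B : MatFamily d K) : 0 ≤ paramLoss n m Sigma A B :=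
  integral_nonneg fun _ => sq_nonneg _

/-- At a structured parameter, the full gradient is controlled by the derivative of the loss
along the structured parameters. -/
theorem totalSqGradNorm_structuredParam_le {d K : ℕ} (n m : ℕ)
    {Sigma : Matrix (Fin d) (Fin d) ℝ} (hSigma : Sigma.PosDef)
    (u : EuclideanSpace ℝ (Fin K ⊕ Fin K)) :
    totalSqGradNorm (paramLoss n m Sigma) (structuredParam K Sigma u).1
        (structuredParam K Sigma u).2 ≤
      (K * ((‖Sigma‖ / d) ^ 2 + (‖(1 : Matrix (Fin d) (Fin d) ℝ)‖ / d) ^ 2)) *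
        ‖fderiv ℝ (fun u => paramLoss n m Sigma (structuredParam K Sigma u).1
          (structuredParam K Sigma u).2) u‖ ^ 2 := by
  set g : EuclideanSpace ℝ (Fin K ⊕ Fin K) → ℝ := fun u =>
    paramLoss n m Sigma (structuredParam K Sigma u).1 (structuredParam K Sigma u).2
  set F : MatFamily d K × MatFamily d K → ℝ := fun θ => paramLoss n m Sigma θ.1 θ.2 with hFdef
  have hF : Differentiable ℝ F := differentiable_paramLoss n m Sigma
  have hg : ∀ h, fderiv ℝ F (structuredParam K Sigma u) (structuredParam K Sigma h) =
      fderiv ℝ g u h := fun h =>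
    (DFunLike.congr_fun (HasFDerivAt.fderiv (f := g) ((hF _).hasFDerivAt.comp u
      (LinearMap.toContinuousLinearMap (structuredParam K Sigma)).hasFDerivAt)) h).symm
  -- Basis vectors of the Euclidean parameter space have norm one, so each partial derivative is at
  -- most the operator norm.
  have hle : ∀ s, (fderiv ℝ g u (EuclideanSpace.single s 1)) ^ 2 ≤ ‖fderiv ℝ g u‖ ^ 2 := fun s => by
    have h := (fderiv ℝ g u).le_opNorm (EuclideanSpace.single s 1)
    rw [PiLp.norm_single, norm_one, mul_one] at h
    rw [← sq_abs, ← Real.norm_eq_abs]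
    gcongr
  have hA : ∀ i, ‖gradA (paramLoss n m Sigma) (structuredParam K Sigma u).1
      (structuredParam K Sigma u).2 i‖ ^ 2 ≤ (‖Sigma‖ / d) ^ 2 * ‖fderiv ℝ g u‖ ^ 2 := fun i => by
    rw [gradA_paramLoss_eq n m hSigma (structuredParam_mem Sigma u), ← structuredParam_single_inl,
      ← hFdef, hg, norm_smul, mul_pow, Real.norm_eq_abs, sq_abs]
    refine le_trans (le_of_eq ?_)
      (mul_le_mul_of_nonneg_left (hle (Sum.inl i)) (sq_nonneg (‖Sigma‖ / d)))
    ring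
  have hB : ∀ i, ‖gradB (paramLoss n m Sigma) (structuredParam K Sigma u).1
      (structuredParam K Sigma u).2 i‖ ^ 2 ≤
        (‖(1 : Matrix (Fin d) (Fin d) ℝ)‖ / d) ^ 2 * ‖fderiv ℝ g u‖ ^ 2 := fun i => by
    rw [gradB_paramLoss_eq n m hSigma (structuredParam_mem Sigma u), ← structuredParam_single_inr,
      ← hFdef, hg, norm_smul, mul_pow, Real.norm_eq_abs, sq_abs]
    refine le_trans (le_of_eq ?_)
      (mul_le_mul_of_nonneg_left (hle (Sum.inr i))
        (sq_nonneg (‖(1 : Matrix (Fin d) (Fin d) ℝ)‖ / d)))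
    ring
  calc totalSqGradNorm (paramLoss n m Sigma) (structuredParam K Sigma u).1
        (structuredParam K Sigma u).2
      ≤ ∑ _i : Fin K, ((‖Sigma‖ / d) ^ 2 * ‖fderiv ℝ g u‖ ^ 2 +
          (‖(1 : Matrix (Fin d) (Fin d) ℝ)‖ / d) ^ 2 * ‖fderiv ℝ g u‖ ^ 2) :=
        Finset.sum_le_sum fun i _ => add_le_add (hA i) (hB i)
    _ = _ := by
        rw [Finset.sum_const, Finset.card_univ, Fintype.card_fin, nsmul_eq_mul]
        ring

theorem isGLB_totalSqGradNorm {d : ℕ} (n m K : ℕ) {Sigma : Matrix (Fin d) (Fin d) ℝ}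
    (hSigma : Sigma.PosDef) :
    IsGLB ((fun θ : MatFamily d K × MatFamily d K =>
      totalSqGradNorm (paramLoss n m Sigma) θ.1 θ.2) '' structuredParams K Sigma) 0 := by
  refine ⟨?_, fun c hc => le_of_forall_pos_le_add fun ε hε => ?_⟩
  · rintro _ ⟨θ, -, rfl⟩
    exact totalSqGradNorm_nonneg _ _ _
  set C : ℝ := K * ((‖Sigma‖ / d) ^ 2 + (‖(1 : Matrix (Fin d) (Fin d) ℝ)‖ / d) ^ 2)
  have hC : 0 ≤ C := by positivity
  have hg : Differentiable ℝ (fun u => paramLoss n m Sigma (structuredParam K Sigma u).1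
      (structuredParam K Sigma u).2) :=
    (differentiable_paramLoss n m Sigma).comp
      (LinearMap.toContinuousLinearMap (structuredParam K Sigma)).differentiable
  -- The tolerance makes the bound `C * ε / (C + 1) ≤ ε`; `C + 1` avoids dividing by a vanishing
  -- `C`.
  obtain ⟨u, hu⟩ := exists_norm_fderiv_lt hg (fun _ => paramLoss_nonneg n m Sigma _ _)
    (Real.sqrt_pos.2 (show 0 < ε / (C + 1) by positivity))
  have hu2 := pow_le_pow_left₀ (norm_nonneg _) hu.le 2
  rw [Real.sq_sqrt (by positivity)] at hu2
  calc c ≤ _ := hc ⟨_, structuredParam_mem Sigma u, rfl⟩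
    _ ≤ C * _ := totalSqGradNorm_structuredParam_le n m hSigma u
    _ ≤ C * (ε / (C + 1)) := by gcongr
    _ ≤ (C + 1) * (ε / (C + 1)) := by gcongr; linarith
    _ = 0 + ε := by field_simp; ring

theorem mainTheorem5 (d n k m : ℕ) (hn : 0 < n) (hm : m = k ∨ m = k + 1)
    (Sigma : Matrix (Fin d) (Fin d) ℝ) (hSigma : Sigma.PosDef) :
    (∀ A B : MatFamily d (k + 1),
      Integrable (promptError (n := n) m (valueWeights B) (keyQueryWeights A))
        (promptLaw n Sigma)) ∧
    Differentiable ℝ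
      (fun θ : MatFamily d (k + 1) × MatFamily d (k + 1) => paramLoss n m Sigma θ.1 θ.2) ∧
    IsGLB
      ((fun θ : MatFamily d (k + 1) × MatFamily d (k + 1) =>
          totalSqGradNorm (paramLoss n m Sigma) θ.1 θ.2) '' structuredParams (k + 1) Sigma) 0 ∧
    (∀ (A B : MatFamily d (k + 1)) (a b : Fin (k + 1) → ℝ),
      (∀ i, A i = a i • Sigma⁻¹) → (∀ i, B i = b i • (1 : Matrix (Fin d) (Fin d) ℝ)) →
      ∀ (x : Fin n ⊕ Unit → EuclideanSpace ℝ (Fin d)) (w : EuclideanSpace ℝ (Fin d))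
        (i : Fin (k + 1)),
        IsPrecondGDppStep Sigma (a i) (b i)
          (hiddenState (valueWeights B) (keyQueryWeights A) (promptMatrix x w) i)
          (hiddenState (valueWeights B) (keyQueryWeights A) (promptMatrix x w) (i + 1))) := by
  refine ⟨fun A B => (isParamSeparable_structured_promptError n m Sigma).integrable (A, B),
    differentiable_paramLoss n m Sigma, isGLB_totalSqGradNorm n m (k + 1) hSigma, ?_⟩
  intro A B a b hA hB x w i
  have h := isPrecondGDppStep_linearAttention Sigma hSigma (a i) (b i)
    (hiddenState (valueWeights B) (keyQueryWeights A) (promptMatrix x w) i)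
  rw [← hA, ← hB] at h
  rwa [hiddenState, dif_pos i.isLt]
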